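/- Consider a training-based multiuser MIMO uplink with $N\ge 1$ receive antennas, $K$ single-antenna users, coherence time $T\in\mathbb N$, and a training phase of $\alpha T\in\mathbb N$ symbols, $0<\alpha<1$. Let $P_0,N_0>0$ be the power budget and the noise level, and let $d_k,\gamma_k,\gamma_k'\ge 0$ $(1\le k\le K)$ be the large-scale fading, pilot power and data power coefficients. Put $D=\mathrm{diag}(d_1,\dots,d_K)$, $R_X=\mathrm{diag}(\alpha\gamma_1P_0T,\dots,\alpha\gamma_KP_0T)$ and $R_{X_d}=\mathrm{diag}(\gamma_1'P_0,\dots,\gamma_K'P_0)$. Let $H\in\mathbb C^{N\times K}$ and $W_p\in\mathbb C^{N\times\alpha T}$ be independent random matrices with i.i.d. $\mathcal{CN}(0,1)$ and $\mathcal{CN}(0,N_0)$ entries, respectively. For a pilot matrix $X_p\in\mathbb C^{K\times\alpha T}$ put $$Y_p=HDX_p+W_p,\qquad \widehat H=Y_p\,(X_p^\dagger D^2X_p+N_0I)^{-1}X_p^\dagger D,$$ $$M=I_K-DX_p(X_p^\dagger D^2X_p+N_0I)^{-1}X_p^\dagger D,\qquad \sigma_v^2=\mathrm{tr}(MD^2R_{X_d})+N_0,$$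 $$R(X_p)=(1-\alpha)\,\mathbb E\Big[\log_2\det\Big(I_N+\tfrac1{\sigma_v^2}\widehat HDR_{X_d}D\widehat H^\dagger\Big)\Big].$$ Consider the pilot-design problem: maximize $R(X_p)$ over all $X_p\in\mathbb C^{K\times\alpha T}$ subject to $(X_pX_p^\dagger)_{\rm diag}=R_X$, where $(A)_{\rm diag}$ denotes $A$ with its off-diagonal entries replaced by $0$. Suppose $K\le\alpha T$. Then the expectation in $R(X_p)$ is that of an integrable random variable for every feasible $X_p$; there exist pilot matrices with $X_pX_p^\dagger=R_X$; and every such $X_p$ is feasible and optimal for the pilot-design problem. Conversely, if every user $k$ with $\gamma_k>0$ has $d_k>0$ and $\gamma_k'>0$, then every optimal $X_p$ satisfies $X_pX_p^\dagger=R_X$. -/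

import Mathlib

open MeasureTheory ProbabilityTheory Matrix

noncomputable section

namespace PilotDesign

/-- The circularly symmetric complex Gaussian law `CN(0, v)`: real and imaginary parts are
independent real Gaussians with mean `0` and variance `v / 2`. -/
def complexGaussian (v : ℝ) : Measure ℂ :=
  ((gaussianReal 0 (v / 2).toNNReal).prod (gaussianReal 0 (v / 2).toNNReal)).map
    Complex.measurableEquivRealProd.symm

instance instIsProbabilityMeasureComplexGaussian (v : ℝ) :
    IsProbabilityMeasure (complexGaussian v) :=
  Measure.isProbabilityMeasure_map Complex.measurableEquivRealProd.symm.measurable.aemeasurable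

/-- The law of an `m × n` random matrix with i.i.d. `CN(0, v)` entries. -/
def gaussianEntries (m n : ℕ) (v : ℝ) : Measure (Fin m → Fin n → ℂ) :=
  Measure.pi fun _ => Measure.pi fun _ => complexGaussian v

/-- Joint law of the small-scale fading matrix `H` (`N × K`, i.i.d. `CN(0, 1)` entries) and of the
independent training noise `W_p` (`N × τ`, i.i.d. `CN(0, N₀)` entries). -/
def channelLaw (N K τ : ℕ) (N₀ : ℝ) : Measure ((Fin N → Fin K → ℂ) × (Fin N → Fin τ → ℂ)) :=
  (gaussianEntries N K 1).prod (gaussianEntries N τ N₀)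

variable {N K τ : ℕ}

/-- `D = diag(d₁, …, d_K)`, the large-scale fading. -/
def fading (d : Fin K → ℝ) : Matrix (Fin K) (Fin K) ℂ :=
  diagonal fun k => (d k : ℂ)

/-- `R_{X_d} = diag(γ'₁ P₀, …, γ'_K P₀)`, the covariance of the data symbols. -/
def dataCov (γ' : Fin K → ℝ) (P₀ : ℝ) : Matrix (Fin K) (Fin K) ℂ :=
  diagonal fun k => ((γ' k * P₀ : ℝ) : ℂ)

/-- `R_X = diag(α γ₁ P₀ T, …, α γ_K P₀ T)`, the prescribed pilot energies. -/
def pilotEnergy (α : ℝ) (T : ℕ) (γ : Fin K → ℝ) (P₀ : ℝ) : Matrix (Fin K) (Fin K) ℂ :=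
  diagonal fun k => ((α * γ k * P₀ * T : ℝ) : ℂ)

/-- The signal received in the training phase, `Y_p = H D X_p + W_p`. -/
def received (d : Fin K → ℝ) (Xp : Matrix (Fin K) (Fin τ) ℂ)
    (H : Matrix (Fin N) (Fin K) ℂ) (W : Matrix (Fin N) (Fin τ) ℂ) : Matrix (Fin N) (Fin τ) ℂ :=
  H * fading d * Xp + W

/-- The per-row covariance `X_p† D² X_p + N₀ I` of the received training signal. -/
def receivedCov (d : Fin K → ℝ) (N₀ : ℝ) (Xp : Matrix (Fin K) (Fin τ) ℂ) :
    Matrix (Fin τ) (Fin τ) ℂ :=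
  Xpᴴ * fading d ^ 2 * Xp + (N₀ : ℂ) • (1 : Matrix (Fin τ) (Fin τ) ℂ)

/-- The MMSE channel estimate `Ĥ = Y_p (X_p† D² X_p + N₀ I)⁻¹ X_p† D`. -/
def channelEstimate (d : Fin K → ℝ) (N₀ : ℝ) (Xp : Matrix (Fin K) (Fin τ) ℂ)
    (Y : Matrix (Fin N) (Fin τ) ℂ) : Matrix (Fin N) (Fin K) ℂ :=
  Y * (receivedCov d N₀ Xp)⁻¹ * Xpᴴ * fading d

/-- The per-row error covariance `M = I - D X_p (X_p† D² X_p + N₀ I)⁻¹ X_p† D`. -/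
def errorCov (d : Fin K → ℝ) (N₀ : ℝ) (Xp : Matrix (Fin K) (Fin τ) ℂ) :
    Matrix (Fin K) (Fin K) ℂ :=
  1 - fading d * Xp * (receivedCov d N₀ Xp)⁻¹ * Xpᴴ * fading d

/-- The equivalent noise power `σ_v² = tr(M D² R_{X_d}) + N₀` (the trace is real). -/
def noisePower (d γ' : Fin K → ℝ) (P₀ N₀ : ℝ) (Xp : Matrix (Fin K) (Fin τ) ℂ) : ℝ :=
  (trace (errorCov d N₀ Xp * fading d ^ 2 * dataCov γ' P₀)).re + N₀

/-- The instantaneous rate `log₂ |I_N + σ_v⁻² Ĥ D R_{X_d} D Ĥ†|` for a realisation `(H, W_p)`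
(the determinant is real and at least one). -/
def instRate (d γ' : Fin K → ℝ) (P₀ N₀ : ℝ) (Xp : Matrix (Fin K) (Fin τ) ℂ)
    (ω : (Fin N → Fin K → ℂ) × (Fin N → Fin τ → ℂ)) : ℝ :=
  let Hhat : Matrix (Fin N) (Fin K) ℂ :=
    channelEstimate d N₀ Xp (received d Xp (Matrix.of ω.1) (Matrix.of ω.2))
  Real.logb 2 (det ((1 : Matrix (Fin N) (Fin N) ℂ) + ((noisePower d γ' P₀ N₀ Xp)⁻¹ : ℂ) •
    (Hhat * fading d * dataCov γ' P₀ * fading d * Hhatᴴ))).re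

/-- The throughput `R = (1 - α) E[log₂ |I_N + σ_v⁻² Ĥ D R_{X_d} D Ĥ†|]`. -/
def throughput (N : ℕ) (α : ℝ) (d γ' : Fin K → ℝ) (P₀ N₀ : ℝ)
    (Xp : Matrix (Fin K) (Fin τ) ℂ) : ℝ :=
  (1 - α) * ∫ ω, instRate d γ' P₀ N₀ Xp ω ∂(channelLaw N K τ N₀)

/-- The pilot power constraint `(X_p X_p†)_diag = R_X`. -/
def IsFeasible (α : ℝ) (T : ℕ) (γ : Fin K → ℝ) (P₀ : ℝ) (Xp : Matrix (Fin K) (Fin τ) ℂ) : Prop :=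
  diagonal (diag (Xp * Xpᴴ)) = pilotEnergy α T γ P₀

/-- `X_p` solves: maximize the throughput subject to `(X_p X_p†)_diag = R_X`. -/
def IsOptimal (N T : ℕ) (α : ℝ) (d γ γ' : Fin K → ℝ) (P₀ N₀ : ℝ)
    (Xp : Matrix (Fin K) (Fin τ) ℂ) : Prop :=
  IsFeasible α T γ P₀ Xp ∧
    ∀ Z : Matrix (Fin K) (Fin τ) ℂ, IsFeasible α T γ P₀ Z →
      throughput N α d γ' P₀ N₀ Z ≤ throughput N α d γ' P₀ N₀ Xp

end PilotDesign

end

/-! The rate depends on the pilots only through one covariance. Up to the factor `σ_v⁻¹`, the matrix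
inside the determinant is the Gram matrix of `Ĥ D R_{X_d}^{1/2}`, which is linear in `(H, W_p)`.
Characteristic functions show that it has the law of `Z S`, with `Z` standard Gaussian and `S† S =
C`, where `C` is `signalCov` (`throughput_eq`).

The expectation `E log det (I + Z C Z†)` does not decrease when the off-diagonal entries of `C` are
dropped and its diagonal is raised to some `b`. The law of `Z` is invariant under column sign
changes, so `C` may be replaced by `s C s` for every sign matrix `s`. For fixed `Z`, bound each such
term by the tangent of `log det` at `I + Z diag(b) Z†`. The tangent is affine, so averaging over `s`
kills the off-diagonal part exactly and leaves a correction weighted by `b k - C k k ≥ 0`. One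
inequality thus gives the comparison (`integral_logDetGram_mul_le`) and its strictness
(`integral_logDetGram_mul_lt`).

It remains to bound the diagonal of `C`. The push-through identity gives `M = N₀ G⁻¹` with `G = D
X_p X_p† D + N₀ I` (`errorCov_eq_smul_inv`). Feasibility fixes the diagonal of `G`, and `(G⁻¹) k k ≥
1 / G k k`, strictly if column `k` of `G` has a nonzero off-diagonal entry. So orthogonal pilots
minimise every error variance and hence also `σ_v²`. Both effects raise the diagonal of `C`, and for
orthogonal pilots `C` is itself diagonal, so the bound is attained. -/

namespace PilotDesign

/-! ### Tangent inequality for `log det`. -/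

section LogDet

open scoped ComplexOrder

variable {n m : Type*} [Fintype n] [DecidableEq n] [Fintype m]

/-- `log det W ≤ tr W - n` for positive definite `W`. -/
theorem log_det_le_trace_sub_card {W : Matrix n n ℂ} (hW : W.PosDef) :
    Real.log W.det.re ≤ W.trace.re - Fintype.card n := by
  have hpos := hW.eigenvalues_pos
  rw [hW.1.det_eq_prod_eigenvalues, hW.1.trace_eq_sum_eigenvalues]
  have h1 : (∏ i, (hW.1.eigenvalues i : ℂ)).re = ∏ i, hW.1.eigenvalues i := by
    rw [← Complex.ofReal_prod, Complex.ofReal_re]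
  have h2 : (∑ i, (hW.1.eigenvalues i : ℂ)).re = ∑ i, hW.1.eigenvalues i := by
    rw [← Complex.ofReal_sum, Complex.ofReal_re]
  erw [h1, h2]
  rw [Real.log_prod (fun i _ => (hpos i).ne')]
  calc ∑ i, Real.log (hW.1.eigenvalues i) ≤ ∑ i, (hW.1.eigenvalues i - 1) :=
        Finset.sum_le_sum fun i _ => Real.log_le_sub_one_of_pos (hpos i)
    _ = _ := by simp

/-- The concave function `log det` lies below its tangent at `X`. -/
theorem log_det_le_log_det_add_trace {X Y : Matrix n n ℂ} (hX : X.PosDef) (hY : Y.PosDef) :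
    Real.log Y.det.re ≤ Real.log X.det.re + (X⁻¹ * Y).trace.re - Fintype.card n := by
  obtain ⟨T, hT⟩ : ∃ T : Matrix n n ℂ, X⁻¹ = Tᴴ * T := by
    open scoped MatrixOrder in
    obtain ⟨T, hT⟩ := CStarAlgebra.nonneg_iff_eq_star_mul_self.mp
      (Matrix.nonneg_iff_posSemidef.mpr hX.inv.posSemidef)
    exact ⟨T, hT⟩
  have hXu : IsUnit X.det := (Matrix.isUnit_iff_isUnit_det _).mp hX.isUnit
  have hdet : Tᴴ.det * T.det * X.det = 1 := by
    rw [← det_mul, ← hT, ← det_mul, nonsing_inv_mul _ hXu, det_one]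
  have hTu : IsUnit T := by
    rw [Matrix.isUnit_iff_isUnit_det, isUnit_iff_ne_zero]
    rintro h
    simp [h] at hdet
  -- Congruence by `T` moves the tangent point from `X` to the identity: the determinant becomes
  -- `det Y / det X` and the trace becomes `tr (X⁻¹ Y)`.
  have hW : (T * Y * Tᴴ).PosDef := by
    have := (Matrix.IsUnit.posDef_star_right_conjugate_iff (x := Y) hTu).mpr hY
    simpa [star_eq_conjTranspose] using this
  have hdetW : (T * Y * Tᴴ).det * X.det = Y.det := by
    rw [det_mul, det_mul]
    linear_combination Y.det * hdet
  have hXpos := hX.det_pos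
  have hWpos := hW.det_pos
  rw [Complex.pos_iff] at hXpos hWpos
  have hre : Y.det.re = (T * Y * Tᴴ).det.re * X.det.re := by
    rw [← hdetW, Complex.mul_re, ← hXpos.2]
    ring
  have htr : (T * Y * Tᴴ).trace = (X⁻¹ * Y).trace := by
    rw [trace_mul_comm, ← Matrix.mul_assoc, ← hT]
  have := log_det_le_trace_sub_card hW
  rw [hre, Real.log_mul hWpos.1.ne' hXpos.1.ne']
  rw [htr] at this
  linarith

/-- `log det (I + M M†)`. -/
noncomputable def logDetGram (M : Matrix n m ℂ) : ℝ :=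
  Real.log (det (1 + M * Mᴴ)).re

theorem posDef_one_add_mul_conjTranspose (M : Matrix n m ℂ) : (1 + M * Mᴴ).PosDef :=
  PosDef.one.add_posSemidef (posSemidef_self_mul_conjTranspose M)

/-- With nonnegativity, this dominates `log det` by a squared Frobenius norm, which yields
integrability. -/
theorem logDetGram_le_trace (M : Matrix n m ℂ) : logDetGram M ≤ (M * Mᴴ).trace.re := by
  have := log_det_le_trace_sub_card (posDef_one_add_mul_conjTranspose M)
  simpa [logDetGram, trace_add] using this

/-- The tangent at `I + M M†`, evaluated at `I`, gives `0 ≤ log det (I + M M†) - tr ((I + M M†)⁻¹ M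
M†)`, and the subtracted trace is nonnegative. -/
theorem logDetGram_nonneg (M : Matrix n m ℂ) : 0 ≤ logDetGram M := by
  have hX := posDef_one_add_mul_conjTranspose M
  have hXu : IsUnit (1 + M * Mᴴ).det := (Matrix.isUnit_iff_isUnit_det _).mp hX.isUnit
  have h := log_det_le_log_det_add_trace hX (PosDef.one (n := n) (R := ℂ))
  have hsplit : (1 + M * Mᴴ)⁻¹ * 1 = 1 - (1 + M * Mᴴ)⁻¹ * (M * Mᴴ) := by
    rw [eq_sub_iff_add_eq, ← Matrix.mul_add, nonsing_inv_mul _ hXu]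
  have htr : 0 ≤ ((1 + M * Mᴴ)⁻¹ * (M * Mᴴ)).trace := by
    rw [← Matrix.mul_assoc, trace_mul_comm, ← Matrix.mul_assoc]
    exact (hX.inv.posSemidef.conjTranspose_mul_mul_same M).trace_nonneg
  have htr' := (Complex.nonneg_iff.mp htr).1
  rw [hsplit, trace_sub, trace_one, Complex.sub_re, det_one, Complex.one_re, Real.log_one,
    Complex.natCast_re] at h
  unfold logDetGram
  linarith

/-! ### Averaging over sign changes. -/

variable [DecidableEq m]

/-- The diagonal matrix of a sign pattern. -/
def signMatrix {κ : Type*} [DecidableEq κ] (s : κ → ℤˣ) : Matrix κ κ ℂ :=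
  diagonal fun k => ((s k : ℤ) : ℂ)

theorem conjTranspose_signMatrix {κ : Type*} [DecidableEq κ] (s : κ → ℤˣ) :
    (signMatrix s)ᴴ = signMatrix s := by
  rw [signMatrix, diagonal_conjTranspose]
  congr 1
  ext k
  simp

theorem signMatrix_mul_self (s : m → ℤˣ) : signMatrix s * signMatrix s = 1 := by
  rw [signMatrix, diagonal_mul_diagonal, ← diagonal_one]
  congr 1
  ext k
  rcases Int.units_eq_one_or (s k) with h | h <;> simp [h]

/-- Averaging over all sign changes removes the off-diagonal entries. -/
theorem sum_signMatrix_conj (B : Matrix m m ℂ) :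
    ∑ s : m → ℤˣ, signMatrix s * B * signMatrix s
      = (Fintype.card (m → ℤˣ) : ℂ) • diagonal (diag B) := by
  ext k l
  rw [Matrix.sum_apply]
  simp only [signMatrix, diagonal_mul, mul_diagonal, Matrix.smul_apply, smul_eq_mul]
  by_cases hkl : k = l
  · subst hkl
    rw [diagonal_apply_eq, diag_apply]
    have (s : m → ℤˣ) : ((s k : ℤ) : ℂ) * B k k * ((s k : ℤ) : ℂ) = B k k := by
      rcases Int.units_eq_one_or (s k) with h | h <;> simp [h]
    simp only [this, Finset.sum_const, Finset.card_univ, nsmul_eq_mul]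
  · rw [diagonal_apply_ne _ hkl, mul_zero]
    -- Flipping the sign at `k` alone permutes the sign patterns and negates the summand, since `l ≠
    -- k`; the sum equals its own negative.
    have hflip := Equiv.sum_comp (Equiv.mulLeft (Function.update (1 : m → ℤˣ) k (-1)))
      (fun s : m → ℤˣ => ((s k : ℤ) : ℂ) * B k l * ((s l : ℤ) : ℂ))
    simp only [Equiv.coe_mulLeft, Pi.mul_apply, Function.update_self,
      Function.update_of_ne (Ne.symm hkl), Pi.one_apply, one_mul, neg_mul, Units.val_neg,
      Int.cast_neg, Finset.sum_neg_distrib] at hflip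
    exact self_eq_neg.mp hflip.symm

/-- The diagonal matrix with entries `√(b k)`. -/
noncomputable def sqrtDiagonal {κ : Type*} [DecidableEq κ] (b : κ → ℝ) : Matrix κ κ ℂ :=
  diagonal fun k => ((√(b k) : ℝ) : ℂ)

theorem conjTranspose_sqrtDiagonal {κ : Type*} [DecidableEq κ] (b : κ → ℝ) :
    (sqrtDiagonal b)ᴴ = sqrtDiagonal b := by
  rw [sqrtDiagonal, diagonal_conjTranspose]
  congr 1
  ext k
  simp

theorem sqrtDiagonal_mul_self {b : m → ℝ} (hb : ∀ k, 0 ≤ b k) :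
    sqrtDiagonal b * sqrtDiagonal b = diagonal fun k => (b k : ℂ) := by
  rw [sqrtDiagonal, diagonal_mul_diagonal]
  congr 1
  ext k
  rw [← Complex.ofReal_mul, Real.mul_self_sqrt (hb k)]

/-- The average of `log det (I + Z s S S† s Z†)` over the sign matrices `s` is at most
`log det (I + Z diag(b) Z†)`, up to a first-order correction. -/
theorem sum_logDetGram_signMatrix_le (Z : Matrix n m ℂ) (S : Matrix m m ℂ) (b : m → ℝ)
    (hb : ∀ k, 0 ≤ b k) :
    ∑ s : m → ℤˣ, logDetGram (Z * (signMatrix s * S)) ≤ Fintype.card (m → ℤˣ) *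
      (logDetGram (Z * sqrtDiagonal b) -
        ∑ k, (b k - ((S * Sᴴ) k k).re) *
          (diag (Zᴴ * (1 + (Z * sqrtDiagonal b) *
            (Z * sqrtDiagonal b)ᴴ)⁻¹ * Z) k).re) := by
  set R : Matrix m m ℂ := sqrtDiagonal b with hR
  set X := 1 + (Z * R) * (Z * R)ᴴ with hXdef
  have hX : X.PosDef := posDef_one_add_mul_conjTranspose _
  have hXu : IsUnit X.det := (Matrix.isUnit_iff_isUnit_det _).mp hX.isUnit
  have hRR : R * Rᴴ = diagonal fun k => (b k : ℂ) := by
    rw [hR, conjTranspose_sqrtDiagonal, sqrtDiagonal_mul_self hb]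
  have hXexp : X = 1 + Z * (diagonal fun k => (b k : ℂ)) * Zᴴ := by
    rw [hXdef, conjTranspose_mul, ← hRR]
    simp only [Matrix.mul_assoc]
  have hterm (s : m → ℤˣ) : (Z * (signMatrix s * S)) * (Z * (signMatrix s * S))ᴴ
      = Z * (signMatrix s * (S * Sᴴ) * signMatrix s) * Zᴴ := by
    simp only [conjTranspose_mul, conjTranspose_signMatrix, Matrix.mul_assoc]
  -- The same tangent point `X` serves every `s`, so the bounds add up to a trace that is linear in
  -- the averaged covariance.
  have hle (s : m → ℤˣ) : logDetGram (Z * (signMatrix s * S)) ≤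
      logDetGram (Z * R) - Fintype.card n
        + (X⁻¹ * (1 + Z * (signMatrix s * (S * Sᴴ) * signMatrix s) * Zᴴ)).trace.re := by
    have := log_det_le_log_det_add_trace hX
      (posDef_one_add_mul_conjTranspose (Z * (signMatrix s * S)))
    rw [hterm] at this
    rw [logDetGram, hterm]
    unfold logDetGram
    linarith
  have hsum : ∑ s : m → ℤˣ,
      X⁻¹ * (1 + Z * (signMatrix s * (S * Sᴴ) * signMatrix s) * Zᴴ)
      = (Fintype.card (m → ℤˣ) : ℂ) • (X⁻¹ * (1 + Z * diagonal (diag (S * Sᴴ)) * Zᴴ)) := by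
    rw [← Matrix.mul_sum, Finset.sum_add_distrib, ← Matrix.sum_mul, ← Matrix.mul_sum,
      sum_signMatrix_conj, Finset.sum_const, Finset.card_univ, ← Nat.cast_smul_eq_nsmul ℂ,
      Matrix.mul_smul, Matrix.smul_mul, ← smul_add, Matrix.mul_smul]
  have hcorr : (X⁻¹ * (1 + Z * diagonal (diag (S * Sᴴ)) * Zᴴ)).trace =
      Fintype.card n - ∑ k, ((b k : ℂ) - (S * Sᴴ) k k) * (Zᴴ * X⁻¹ * Z) k k := by
    have h1 : 1 + Z * diagonal (diag (S * Sᴴ)) * Zᴴ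
        = X - Z * diagonal (fun k => (b k : ℂ) - (S * Sᴴ) k k) * Zᴴ := by
      have : diagonal (diag (S * Sᴴ)) = (diagonal fun k => (b k : ℂ))
          - diagonal (fun k => (b k : ℂ) - (S * Sᴴ) k k) := by
        rw [diagonal_sub]
        congr 1
        ext k
        simp
      rw [this, hXexp, Matrix.mul_sub, Matrix.sub_mul]
      abel
    rw [h1, Matrix.mul_sub, nonsing_inv_mul _ hXu, trace_sub, trace_one]
    congr 1
    rw [← Matrix.mul_assoc, trace_mul_comm, ← Matrix.mul_assoc, ← Matrix.mul_assoc]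
    simp only [trace, diag_apply, mul_diagonal]
    exact Finset.sum_congr rfl fun k _ => mul_comm _ _
  have him (k : m) : ((S * Sᴴ) k k).im = 0 :=
    ((Complex.nonneg_iff.mp (posSemidef_self_mul_conjTranspose S).diag_nonneg).2).symm
  calc ∑ s : m → ℤˣ, logDetGram (Z * (signMatrix s * S))
      ≤ ∑ s : m → ℤˣ, (logDetGram (Z * R) - Fintype.card n
        + (X⁻¹ * (1 + Z * (signMatrix s * (S * Sᴴ) * signMatrix s) * Zᴴ)).trace.re) :=
        Finset.sum_le_sum fun s _ => hle s
    _ = _ := by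
      rw [Finset.sum_add_distrib, Finset.sum_const, Finset.card_univ, nsmul_eq_mul,
        ← Complex.re_sum, ← trace_sum, hsum, trace_smul, hcorr, smul_eq_mul,
        ← Complex.ofReal_natCast, Complex.re_ofReal_mul, Complex.sub_re, Complex.re_sum,
        Complex.natCast_re]
      simp only [Complex.mul_re, Complex.sub_re, Complex.sub_im, Complex.ofReal_re,
        Complex.ofReal_im, him, sub_self, zero_mul, sub_zero, diag_apply]
      ring

end LogDet

/-! ### Laws of linear images of Gaussian matrices. -/

section Law

variable {N K L τ : ℕ}

/-- The exponent splits as `w.re * x + w.im * y` with `x`, `y` independent of variance `v / 2`,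
hence the constant `v / 4`. -/
theorem integral_exp_complexGaussian {v : ℝ} (hv : 0 ≤ v) (w : ℂ) :
    ∫ z, Complex.exp (((z * star w).re : ℂ) * Complex.I) ∂complexGaussian v
      = Complex.exp (-(v / 4) * ((w * star w).re : ℂ)) := by
  have h (t : ℝ) : ∫ x, Complex.exp ((t : ℂ) * x * Complex.I) ∂gaussianReal 0 (v / 2).toNNReal
      = Complex.exp (-(v / 4) * (t : ℂ) ^ 2) := by
    rw [← charFun_apply_real, charFun_gaussianReal, Real.coe_toNNReal _ (by positivity)]
    congr 1
    push_cast
    ring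
  rw [complexGaussian, integral_map_equiv]
  have hsplit (p : ℝ × ℝ) :
      Complex.exp (((Complex.measurableEquivRealProd.symm p * star w).re : ℂ) * Complex.I)
        = Complex.exp ((w.re : ℂ) * p.1 * Complex.I)
          * Complex.exp ((w.im : ℂ) * p.2 * Complex.I) := by
    rw [← Complex.exp_add]
    congr 1
    simp [Complex.measurableEquivRealProd_symm_apply]
    ring
  simp_rw [hsplit]
  rw [integral_prod_mul (fun x : ℝ => Complex.exp ((w.re : ℂ) * x * Complex.I))
    (fun x : ℝ => Complex.exp ((w.im : ℂ) * x * Complex.I)), h, h, ← Complex.exp_add]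
  congr 1
  simp
  ring

instance instIsProbabilityMeasureGaussianEntries (m n : ℕ) (v : ℝ) :
    IsProbabilityMeasure (gaussianEntries m n v) := by
  unfold gaussianEntries
  infer_instance

instance instIsProbabilityMeasureChannelLaw (N₀ : ℝ) :
    IsProbabilityMeasure (channelLaw N K τ N₀) := by
  unfold channelLaw
  infer_instance

theorem re_trace_mul_conjTranspose (Z Θ : Matrix (Fin N) (Fin K) ℂ) :
    (Z * Θᴴ).trace.re = ∑ n, ∑ k, (Z n k * star (Θ n k)).re := by
  simp only [trace, diag_apply, mul_apply, conjTranspose_apply, Complex.re_sum]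

theorem integral_exp_gaussianEntries {v : ℝ} (hv : 0 ≤ v) (Θ : Matrix (Fin N) (Fin K) ℂ) :
    ∫ Z, Complex.exp (((Matrix.of Z * Θᴴ).trace.re : ℂ) * Complex.I) ∂gaussianEntries N K v
      = Complex.exp (-(v / 4) * ((Θ * Θᴴ).trace.re : ℂ)) := by
  simp only [re_trace_mul_conjTranspose, Complex.ofReal_sum, Finset.sum_mul, Finset.mul_sum,
    Complex.exp_sum, Matrix.of_apply, ← integral_exp_complexGaussian hv]
  rw [gaussianEntries, integral_fintype_prod_eq_prod (fun n (z : Fin K → ℂ) =>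
    ∏ k, Complex.exp (((z k * star (Θ n k)).re : ℂ) * Complex.I))]
  refine Finset.prod_congr rfl fun n _ => ?_
  exact integral_fintype_prod_eq_prod (fun k (z : ℂ) =>
    Complex.exp (((z * star (Θ n k)).re : ℂ) * Complex.I))

/-- As `Re (z * conj θ) = z.re * θ.re + z.im * θ.im`, the real and imaginary parts of each entry of
`Θ` are the values of `l` on the real and imaginary unit at that position. Uniqueness of laws is
thereby a question about `Re tr (Z Θ†)` only. -/
theorem exists_strongDual_eq_re_trace (l : StrongDual ℝ (Fin N → Fin L → ℂ)) :
    ∃ Θ : Matrix (Fin N) (Fin L) ℂ, ∀ Z, l Z = (Matrix.of Z * Θᴴ).trace.re := by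
  let e (n : Fin N) (k : Fin L) (c : ℂ) : Fin N → Fin L → ℂ := Pi.single n (Pi.single k c)
  refine ⟨Matrix.of fun n k => ⟨l (e n k 1), l (e n k Complex.I)⟩, fun Z => ?_⟩
  have hZ : Z = ∑ n, ∑ k, ((Z n k).re • e n k 1 + (Z n k).im • e n k Complex.I) := by
    ext n k
    simp only [e, Finset.sum_apply, Pi.add_apply, Pi.smul_apply]
    rw [Finset.sum_eq_single n, Finset.sum_eq_single k]
    · simp [Complex.re_add_im]
    · intro k' _ hk
      simp [Pi.single_eq_of_ne (Ne.symm hk)]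
    · simp
    · intro n' _ hn
      simp [Pi.single_eq_of_ne (Ne.symm hn)]
    · simp
  conv_lhs => rw [hZ]
  simp only [map_sum, map_add, map_smul, re_trace_mul_conjTranspose]
  simp

/-- The characteristic function `Θ ↦ E exp(i Re tr(Z Θ†))` determines the law of a random
matrix `Z`. -/
theorem ext_of_re_trace {μ ν : Measure (Fin N → Fin L → ℂ)} [IsFiniteMeasure μ] [IsFiniteMeasure ν]
    (h : ∀ Θ : Matrix (Fin N) (Fin L) ℂ,
      ∫ Z, Complex.exp (((Matrix.of Z * Θᴴ).trace.re : ℂ) * Complex.I) ∂μ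
        = ∫ Z, Complex.exp (((Matrix.of Z * Θᴴ).trace.re : ℂ) * Complex.I) ∂ν) : μ = ν := by
  refine Measure.ext_of_charFunDual (funext fun l => ?_)
  obtain ⟨Θ, hΘ⟩ := exists_strongDual_eq_re_trace l
  simp only [charFunDual_apply, hΘ]
  exact h Θ

theorem measurable_of_mul (S : Matrix (Fin K) (Fin L) ℂ) :
    Measurable fun Z : Fin N → Fin K → ℂ => Matrix.of.symm (Matrix.of Z * S) := by
  refine Continuous.measurable (continuous_pi fun n => continuous_pi fun l => ?_)
  simp only [Matrix.of_symm_apply, mul_apply, Matrix.of_apply]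
  fun_prop

theorem measurable_re_trace (Θ : Matrix (Fin N) (Fin L) ℂ) :
    Measurable fun Z : Fin N → Fin L → ℂ =>
      Complex.exp (((Matrix.of Z * Θᴴ).trace.re : ℂ) * Complex.I) := by
  simp only [re_trace_mul_conjTranspose, Matrix.of_apply]
  fun_prop

theorem integral_exp_map_gaussianEntries {v : ℝ} (hv : 0 ≤ v) (S : Matrix (Fin K) (Fin L) ℂ)
    (Θ : Matrix (Fin N) (Fin L) ℂ) :
    ∫ Z, Complex.exp (((Matrix.of Z * S * Θᴴ).trace.re : ℂ) * Complex.I) ∂gaussianEntries N K v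
      = Complex.exp (-(v / 4) * ((Θ * (Sᴴ * S) * Θᴴ).trace.re : ℂ)) := by
  have h := integral_exp_gaussianEntries hv (Θ * Sᴴ)
  simpa only [conjTranspose_mul, conjTranspose_conjTranspose, Matrix.mul_assoc] using h

/-- The law of `Z S` depends on `S† S` only. -/
theorem map_mul_gaussianEntries_congr {K' : ℕ} {S : Matrix (Fin K) (Fin L) ℂ}
    {S' : Matrix (Fin K') (Fin L) ℂ} (h : Sᴴ * S = S'ᴴ * S') :
    (gaussianEntries N K 1).map (fun Z => Matrix.of.symm (Matrix.of Z * S))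
      = (gaussianEntries N K' 1).map (fun Z => Matrix.of.symm (Matrix.of Z * S')) := by
  have := Measure.isProbabilityMeasure_map (μ := gaussianEntries N K 1)
    (measurable_of_mul (N := N) S).aemeasurable
  have := Measure.isProbabilityMeasure_map (μ := gaussianEntries N K' 1)
    (measurable_of_mul (N := N) S').aemeasurable
  refine ext_of_re_trace fun Θ => ?_
  rw [integral_map (measurable_of_mul S).aemeasurable (measurable_re_trace Θ).aestronglyMeasurable,
    integral_map (measurable_of_mul S').aemeasurable
      (measurable_re_trace Θ).aestronglyMeasurable]
  simp only [Equiv.apply_symm_apply]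
  rw [integral_exp_map_gaussianEntries zero_le_one, integral_exp_map_gaussianEntries zero_le_one, h]

theorem measurable_mul_add_mul (U : Matrix (Fin K) (Fin L) ℂ) (V : Matrix (Fin τ) (Fin L) ℂ) :
    Measurable fun ω : (Fin N → Fin K → ℂ) × (Fin N → Fin τ → ℂ) =>
      Matrix.of.symm (Matrix.of ω.1 * U + Matrix.of ω.2 * V) := by
  refine Continuous.measurable (continuous_pi fun n => continuous_pi fun l => ?_)
  simp only [Matrix.of_symm_apply, mul_apply, Matrix.of_apply, Matrix.add_apply]
  fun_prop

/-- The law of `H U + W V` under the channel law is that of `Z S` with `Z` a standard Gaussian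
matrix, if the row covariances agree. -/
theorem map_mul_add_mul_channelLaw {K' : ℕ} {N₀ : ℝ} (hN₀ : 0 ≤ N₀)
    {U : Matrix (Fin K) (Fin L) ℂ} {V : Matrix (Fin τ) (Fin L) ℂ}
    {S : Matrix (Fin K') (Fin L) ℂ} (h : Uᴴ * U + (N₀ : ℂ) • (Vᴴ * V) = Sᴴ * S) :
    (channelLaw N K τ N₀).map (fun ω => Matrix.of.symm (Matrix.of ω.1 * U + Matrix.of ω.2 * V))
      = (gaussianEntries N K' 1).map (fun Z => Matrix.of.symm (Matrix.of Z * S)) := by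
  have := Measure.isProbabilityMeasure_map (μ := channelLaw N K τ N₀)
    (measurable_mul_add_mul U V).aemeasurable
  have := Measure.isProbabilityMeasure_map (μ := gaussianEntries N K' 1)
    (measurable_of_mul (N := N) S).aemeasurable
  refine ext_of_re_trace fun Θ => ?_
  rw [integral_map (measurable_mul_add_mul U V).aemeasurable
      (measurable_re_trace Θ).aestronglyMeasurable,
    integral_map (measurable_of_mul S).aemeasurable (measurable_re_trace Θ).aestronglyMeasurable]
  simp only [Equiv.apply_symm_apply, Matrix.add_mul, trace_add, Complex.add_re, Complex.ofReal_add,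
    add_mul, Complex.exp_add]
  rw [integral_exp_map_gaussianEntries zero_le_one, channelLaw,
    integral_prod_mul
      (fun Z : Fin N → Fin K → ℂ =>
        Complex.exp (((Matrix.of Z * U * Θᴴ).trace.re : ℂ) * Complex.I))
      (fun Z : Fin N → Fin τ → ℂ =>
        Complex.exp (((Matrix.of Z * V * Θᴴ).trace.re : ℂ) * Complex.I)),
    integral_exp_map_gaussianEntries zero_le_one, integral_exp_map_gaussianEntries hN₀,
    ← Complex.exp_add, ← h]
  congr 1
  simp only [Matrix.mul_add, Matrix.add_mul, Matrix.mul_smul, Matrix.smul_mul, trace_add,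
    trace_smul, Complex.add_re, smul_eq_mul, Complex.re_ofReal_mul, Complex.ofReal_add,
    Complex.ofReal_mul, Complex.ofReal_one]
  ring

end Law

/-! ### Integrability and transfer of expectations. -/

section Expectation

variable {N K L τ : ℕ}

theorem memLp_id_complexGaussian (v : ℝ) : MemLp id 2 (complexGaussian v) := by
  rw [complexGaussian, memLp_map_measure_iff aestronglyMeasurable_id
    Complex.measurableEquivRealProd.symm.measurable.aemeasurable]
  have h (v : NNReal) : MemLp (fun x : ℝ => (x : ℂ)) 2 (gaussianReal 0 v) :=
    (memLp_id_gaussianReal 2).ofReal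
  have h1 := (h (v / 2).toNNReal).comp_fst (gaussianReal 0 (v / 2).toNNReal)
  have h2 := (h (v / 2).toNNReal).comp_snd (gaussianReal 0 (v / 2).toNNReal)
  refine (h1.add (h2.const_mul Complex.I)).ae_eq (ae_of_all _ fun p => ?_)
  apply Complex.ext <;> simp [Complex.measurableEquivRealProd_symm_apply]

theorem measurePreserving_entry_gaussianEntries (v : ℝ) (n : Fin N) (k : Fin K) :
    MeasurePreserving (fun Z : Fin N → Fin K → ℂ => Z n k) (gaussianEntries N K v)
      (complexGaussian v) :=
  (measurePreserving_eval (fun _ : Fin K => complexGaussian v) k).comp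
    (measurePreserving_eval (fun _ : Fin N => Measure.pi fun _ : Fin K => complexGaussian v) n)

theorem measurable_logDetGram :
    Measurable fun Z : Fin N → Fin L → ℂ => logDetGram (Matrix.of Z) := by
  refine Real.measurable_log.comp (Complex.measurable_re.comp (Continuous.measurable ?_))
  refine Continuous.matrix_det (continuous_const.add (Continuous.matrix_mul ?_ ?_))
  · exact continuous_id
  · exact Continuous.matrix_conjTranspose continuous_id

theorem integrable_logDetGram_mul (S : Matrix (Fin K) (Fin L) ℂ) :
    Integrable (fun Z : Fin N → Fin K → ℂ => logDetGram (Matrix.of Z * S))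
      (gaussianEntries N K 1) := by
  have hmem (n : Fin N) (l : Fin L) :
      MemLp (fun Z : Fin N → Fin K → ℂ => (Matrix.of Z * S) n l) 2 (gaussianEntries N K 1) := by
    simp only [mul_apply, Matrix.of_apply]
    refine memLp_finsetSum _ fun k _ => MemLp.mul_const ?_ _
    exact (memLp_id_complexGaussian 1).comp_measurePreserving
      (measurePreserving_entry_gaussianEntries 1 n k)
  -- The entries of `Z S` are square integrable, and the trace is the sum of their squared moduli.
  have hbound : Integrable
      (fun Z : Fin N → Fin K → ℂ => ((Matrix.of Z * S) * (Matrix.of Z * S)ᴴ).trace.re)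
      (gaussianEntries N K 1) := by
    simp only [re_trace_mul_conjTranspose]
    refine integrable_finsetSum _ fun n _ => integrable_finsetSum _ fun l _ => ?_
    refine (hmem n l).integrable_norm_pow'.congr (ae_of_all _ fun Z => ?_)
    beta_reduce
    rw [RCLike.star_def, Complex.mul_conj, Complex.normSq_eq_norm_sq, Complex.ofReal_re]
  refine hbound.mono' ?_ (ae_of_all _ fun Z => ?_)
  · exact (measurable_logDetGram.comp (measurable_of_mul S)).aestronglyMeasurable
  · rw [Real.norm_of_nonneg (logDetGram_nonneg _)]
    exact logDetGram_le_trace _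

theorem integral_logDetGram_mul_congr {K' : ℕ} {S : Matrix (Fin K) (Fin L) ℂ}
    {S' : Matrix (Fin K') (Fin L) ℂ} (h : Sᴴ * S = S'ᴴ * S') :
    ∫ Z, logDetGram (Matrix.of Z * S) ∂gaussianEntries N K 1
      = ∫ Z, logDetGram (Matrix.of Z * S') ∂gaussianEntries N K' 1 := by
  have h1 := integral_map (μ := gaussianEntries N K 1) (measurable_of_mul (N := N) S).aemeasurable
    measurable_logDetGram.aestronglyMeasurable
  have h2 := integral_map (μ := gaussianEntries N K' 1)
    (measurable_of_mul (N := N) S').aemeasurable measurable_logDetGram.aestronglyMeasurable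
  rw [map_mul_gaussianEntries_congr h] at h1
  exact h1.symm.trans h2

theorem integrable_logDetGram_channelLaw {N₀ : ℝ} (hN₀ : 0 ≤ N₀) {U : Matrix (Fin K) (Fin L) ℂ}
    {V : Matrix (Fin τ) (Fin L) ℂ} {S : Matrix (Fin L) (Fin L) ℂ}
    (h : Uᴴ * U + (N₀ : ℂ) • (Vᴴ * V) = Sᴴ * S) :
    Integrable (fun ω => logDetGram (Matrix.of ω.1 * U + Matrix.of ω.2 * V))
      (channelLaw N K τ N₀) := by
  have h1 := integrable_map_measure (μ := channelLaw N K τ N₀)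
    measurable_logDetGram.aestronglyMeasurable
    (measurable_mul_add_mul (N := N) U V).aemeasurable
  have h2 := integrable_map_measure (μ := gaussianEntries N L 1)
    measurable_logDetGram.aestronglyMeasurable (measurable_of_mul (N := N) S).aemeasurable
  rw [map_mul_add_mul_channelLaw hN₀ h] at h1
  exact h1.mp (h2.mpr (integrable_logDetGram_mul S))

theorem integral_logDetGram_channelLaw {N₀ : ℝ} (hN₀ : 0 ≤ N₀) {U : Matrix (Fin K) (Fin L) ℂ}
    {V : Matrix (Fin τ) (Fin L) ℂ} {S : Matrix (Fin L) (Fin L) ℂ}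
    (h : Uᴴ * U + (N₀ : ℂ) • (Vᴴ * V) = Sᴴ * S) :
    ∫ ω, logDetGram (Matrix.of ω.1 * U + Matrix.of ω.2 * V) ∂channelLaw N K τ N₀
      = ∫ Z, logDetGram (Matrix.of Z * S) ∂gaussianEntries N L 1 := by
  have h1 := integral_map (μ := channelLaw N K τ N₀)
    (measurable_mul_add_mul (N := N) U V).aemeasurable measurable_logDetGram.aestronglyMeasurable
  have h2 := integral_map (μ := gaussianEntries N L 1)
    (measurable_of_mul (N := N) S).aemeasurable measurable_logDetGram.aestronglyMeasurable
  rw [map_mul_add_mul_channelLaw hN₀ h] at h1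
  exact h1.symm.trans h2

/-! ### Comparison of covariances in expectation. -/

section Compare

open scoped ComplexOrder

variable {S : Matrix (Fin K) (Fin K) ℂ} {b : Fin K → ℝ}

theorem re_diag_conj_pos {A : Matrix (Fin N) (Fin N) ℂ} (hA : A.PosDef)
    {Z : Matrix (Fin N) (Fin K) ℂ} {n : Fin N} {k : Fin K} (h : Z n k ≠ 0) :
    0 < (diag (Zᴴ * A * Z) k).re := by
  have hz : (fun n => Z n k) ≠ 0 := fun h0 => h (congrFun h0 n)
  have hpos := hA.dotProduct_mulVec_pos hz
  have hdiag : diag (Zᴴ * A * Z) k = star (fun n => Z n k) ⬝ᵥ A *ᵥ (fun n => Z n k) := by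
    simp only [diag_apply, Matrix.mul_assoc, mul_apply, conjTranspose_apply, dotProduct, mulVec,
      Pi.star_apply]
  rw [hdiag]
  exact (Complex.pos_iff.mp hpos).1

theorem re_diag_conj_nonneg {A : Matrix (Fin N) (Fin N) ℂ} (hA : A.PosSemidef)
    (Z : Matrix (Fin N) (Fin K) ℂ) (k : Fin K) : 0 ≤ (diag (Zᴴ * A * Z) k).re :=
  (Complex.nonneg_iff.mp (hA.conjTranspose_mul_mul_same Z).diag_nonneg).1

theorem sum_logDetGram_signMatrix_le_of_diag_le (hb : ∀ k, 0 ≤ b k)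
    (h : ∀ k, ((S * Sᴴ) k k).re ≤ b k) (Z : Matrix (Fin N) (Fin K) ℂ) :
    ∑ s : Fin K → ℤˣ, logDetGram (Z * (signMatrix s * S))
      ≤ Fintype.card (Fin K → ℤˣ) * logDetGram (Z * sqrtDiagonal b) := by
  refine (sum_logDetGram_signMatrix_le Z S b hb).trans
    (mul_le_mul_of_nonneg_left (sub_le_self _ ?_) (Nat.cast_nonneg _))
  exact Finset.sum_nonneg fun k _ => mul_nonneg (sub_nonneg.mpr (h k))
    (re_diag_conj_nonneg (posDef_one_add_mul_conjTranspose _).inv.posSemidef Z k)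

theorem sum_logDetGram_signMatrix_lt (hb : ∀ k, 0 ≤ b k)
    (h : ∀ k, ((S * Sᴴ) k k).re ≤ b k) {i : Fin K} (hi : ((S * Sᴴ) i i).re < b i)
    {Z : Matrix (Fin N) (Fin K) ℂ} {n : Fin N} (hZ : Z n i ≠ 0) :
    ∑ s : Fin K → ℤˣ, logDetGram (Z * (signMatrix s * S))
      < Fintype.card (Fin K → ℤˣ) * logDetGram (Z * sqrtDiagonal b) := by
  refine (sum_logDetGram_signMatrix_le Z S b hb).trans_lt
    (mul_lt_mul_of_pos_left (sub_lt_self _ ?_) (Nat.cast_pos.mpr Fintype.card_pos))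
  refine Finset.sum_pos' (fun k _ => mul_nonneg (sub_nonneg.mpr (h k))
    (re_diag_conj_nonneg (posDef_one_add_mul_conjTranspose _).inv.posSemidef Z k))
    ⟨i, Finset.mem_univ i, mul_pos (sub_pos.mpr hi)
      (re_diag_conj_pos (posDef_one_add_mul_conjTranspose _).inv hZ)⟩

/-- Left multiplication of `S` by a sign matrix keeps `S† S`, hence the law of `Z S`, while it
conjugates `S S†`. -/
theorem integral_sum_logDetGram_signMatrix (S : Matrix (Fin K) (Fin K) ℂ) :
    ∫ Z, ∑ s : Fin K → ℤˣ, logDetGram (Matrix.of Z * (signMatrix s * S)) ∂gaussianEntries N K 1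
      = Fintype.card (Fin K → ℤˣ)
        * ∫ Z, logDetGram (Matrix.of Z * S) ∂gaussianEntries N K 1 := by
  rw [integral_finsetSum _ fun s _ => integrable_logDetGram_mul _]
  have (s : Fin K → ℤˣ) : (signMatrix s * S)ᴴ * (signMatrix s * S) = Sᴴ * S := by
    rw [conjTranspose_mul, conjTranspose_signMatrix, Matrix.mul_assoc, ← Matrix.mul_assoc _ _ S,
      signMatrix_mul_self, Matrix.one_mul]
  simp only [integral_logDetGram_mul_congr (this _), Finset.sum_const, Finset.card_univ,
    nsmul_eq_mul]

/-- Enlarging the diagonal of the covariance and removing its off-diagonal entries increases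
`E log det (I + Z S S† Z†)`. -/
theorem integral_logDetGram_mul_le (hb : ∀ k, 0 ≤ b k) (h : ∀ k, ((S * Sᴴ) k k).re ≤ b k) :
    ∫ Z, logDetGram (Matrix.of Z * S) ∂gaussianEntries N K 1
      ≤ ∫ Z, logDetGram (Matrix.of Z * sqrtDiagonal b) ∂gaussianEntries N K 1 := by
  have hcard : (0 : ℝ) < Fintype.card (Fin K → ℤˣ) := Nat.cast_pos.mpr Fintype.card_pos
  refine le_of_mul_le_mul_left ?_ hcard
  rw [← integral_sum_logDetGram_signMatrix, ← integral_const_mul]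
  exact integral_mono (integrable_finsetSum _ fun s _ => integrable_logDetGram_mul _)
    ((integrable_logDetGram_mul _).const_mul _)
    fun Z => sum_logDetGram_signMatrix_le_of_diag_le hb h (Matrix.of Z)

/-- An entry vanishing almost surely would have characteristic function `1`, but at `1` its value is
`exp (-1/4)`. -/
theorem not_ae_entry_eq_zero (n : Fin N) (k : Fin K) :
    ¬ ∀ᵐ Z ∂gaussianEntries N K 1, Z n k = 0 := by
  intro h
  have h0 : ∀ᵐ z ∂complexGaussian 1, z = 0 := by
    rw [← (measurePreserving_entry_gaussianEntries 1 n k).map_eq]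
    exact (ae_map_iff (measurePreserving_entry_gaussianEntries 1 n k).measurable.aemeasurable
      (measurableSet_singleton (0 : ℂ))).mpr h
  have h1 := integral_exp_complexGaussian zero_le_one 1
  rw [integral_congr_ae (g := fun _ => (1 : ℂ)) (h0.mono fun z hz => by simp [hz])] at h1
  have h2 := congrArg norm h1
  rw [Complex.norm_exp] at h2
  norm_num at h2
  exact (Real.exp_lt_one_iff.mpr (by norm_num)).ne h2.symm

/-- Equal integrals would force almost sure equality in the pointwise bound. That bound is strict
whenever column `i` of `Z` has a nonzero entry, and `0 < N` supplies an entry to test. -/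
theorem integral_logDetGram_mul_lt (hN : 0 < N) (hb : ∀ k, 0 ≤ b k)
    (h : ∀ k, ((S * Sᴴ) k k).re ≤ b k) {i : Fin K} (hi : ((S * Sᴴ) i i).re < b i) :
    ∫ Z, logDetGram (Matrix.of Z * S) ∂gaussianEntries N K 1
      < ∫ Z, logDetGram (Matrix.of Z * sqrtDiagonal b) ∂gaussianEntries N K 1 := by
  refine lt_of_le_of_ne (integral_logDetGram_mul_le hb h) fun heq => ?_
  have hsum : ∫ Z, ∑ s : Fin K → ℤˣ, logDetGram (Matrix.of Z * (signMatrix s * S))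
        ∂gaussianEntries N K 1
      = ∫ Z, Fintype.card (Fin K → ℤˣ) * logDetGram (Matrix.of Z * sqrtDiagonal b)
        ∂gaussianEntries N K 1 := by
    rw [integral_sum_logDetGram_signMatrix, integral_const_mul, heq]
  rw [integral_eq_iff_of_ae_le (integrable_finsetSum _ fun s _ => integrable_logDetGram_mul _)
    ((integrable_logDetGram_mul _).const_mul _)
    (ae_of_all _ fun Z => sum_logDetGram_signMatrix_le_of_diag_le hb h (Matrix.of Z))] at hsum
  refine not_ae_entry_eq_zero ⟨0, hN⟩ i (hsum.mono fun Z hZ => ?_)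
  by_contra hne
  exact (sum_logDetGram_signMatrix_lt hb h hi (Z := Matrix.of Z) hne).ne hZ

end Compare

end Expectation

/-! ### Diagonal entries of an inverse. -/

section Inverse

open scoped ComplexOrder

variable {K : ℕ} {Q : Matrix (Fin K) (Fin K) ℂ}

/-- A completed square: with `r = 1 / Q k k` the product expands to `Q⁻¹ - 2 r I + r² Q`, whose
`k`-th diagonal entry is `(Q⁻¹) k k - r`. It makes the gap visibly nonnegative. -/
theorem diag_inv_sub_conj (hQ : Q.PosDef) (k : Fin K) :
    (diag ((Q⁻¹ - (Q k k)⁻¹ • (1 : Matrix (Fin K) (Fin K) ℂ))ᴴ * Q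
      * (Q⁻¹ - (Q k k)⁻¹ • (1 : Matrix (Fin K) (Fin K) ℂ))) k).re
      = (Q⁻¹ k k).re - (Q k k).re⁻¹ := by
  have hpos := Complex.pos_iff.mp (hQ.diag_pos (i := k))
  have hreal : Q k k = ((Q k k).re : ℂ) := Complex.ext rfl hpos.2.symm
  have hu : IsUnit Q.det := (Matrix.isUnit_iff_isUnit_det _).mp hQ.isUnit
  set r := (Q k k)⁻¹ with hr
  have hstar : star r = r := by rw [hr, hreal]; simp
  have hexp : (Q⁻¹ - r • (1 : Matrix (Fin K) (Fin K) ℂ))ᴴ * Q * (Q⁻¹ - r • 1)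
      = Q⁻¹ - (2 * r) • 1 + (r * r) • Q := by
    rw [conjTranspose_sub, conjTranspose_smul, hstar, conjTranspose_one, hQ.inv.1.eq]
    simp only [Matrix.sub_mul, Matrix.mul_sub, Matrix.smul_mul, Matrix.mul_smul, Matrix.one_mul,
      Matrix.mul_one, nonsing_inv_mul _ hu, mul_nonsing_inv _ hu, smul_sub, smul_smul]
    module
  have hentry : (Q⁻¹ - (2 * r) • 1 + (r * r) • Q) k k = Q⁻¹ k k - r := by
    have : r * r * Q k k = r := by
      rw [mul_assoc, hr, inv_mul_cancel₀ (hQ.diag_pos (i := k)).ne', mul_one]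
    simp only [Matrix.add_apply, Matrix.sub_apply, Matrix.smul_apply, one_apply_eq, smul_eq_mul,
      mul_one, this]
    ring
  rw [hexp, diag_apply, hentry, Complex.sub_re, hr, hreal, ← Complex.ofReal_inv, Complex.ofReal_re,
    Complex.ofReal_re]

theorem inv_re_diag_le (hQ : Q.PosDef) (k : Fin K) : (Q k k).re⁻¹ ≤ (Q⁻¹ k k).re := by
  rw [← sub_nonneg, ← diag_inv_sub_conj hQ]
  exact re_diag_conj_nonneg hQ.posSemidef _ _

theorem inv_re_diag_lt (hQ : Q.PosDef) {l k : Fin K} (hlk : l ≠ k) (h : Q l k ≠ 0) :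
    (Q k k).re⁻¹ < (Q⁻¹ k k).re := by
  have hu : IsUnit Q.det := (Matrix.isUnit_iff_isUnit_det _).mp hQ.isUnit
  rw [← sub_pos, ← diag_inv_sub_conj hQ]
  -- If column `k` of `Q⁻¹ - r I` vanished, so would column `k` of `I - r Q`, contradicting `Q l k ≠
  -- 0`.
  obtain ⟨n, hn⟩ : ∃ n, (Q⁻¹ - (Q k k)⁻¹ • (1 : Matrix (Fin K) (Fin K) ℂ)) n k ≠ 0 := by
    by_contra! h0
    have h1 : (Q * (Q⁻¹ - (Q k k)⁻¹ • (1 : Matrix (Fin K) (Fin K) ℂ))) l k = 0 := by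
      rw [mul_apply]
      exact Finset.sum_eq_zero fun n _ => by rw [h0 n, mul_zero]
    rw [Matrix.mul_sub, mul_nonsing_inv _ hu, Matrix.mul_smul, Matrix.mul_one, Matrix.sub_apply,
      one_apply_ne hlk, Matrix.smul_apply, smul_eq_mul, zero_sub, neg_eq_zero, mul_eq_zero] at h1
    exact h1.elim (inv_ne_zero (hQ.diag_pos (i := k)).ne') h
  exact re_diag_conj_pos hQ hn

end Inverse

/-! ### Reduction of the throughput to a standard Gaussian expectation. -/

section Estimate

open scoped ComplexOrder

variable {N K τ : ℕ} {d γ' : Fin K → ℝ} {P₀ N₀ : ℝ} {Xp : Matrix (Fin K) (Fin τ) ℂ}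

/-- The received data powers `d_k² γ'_k P₀`. -/
def receivedPower (d γ' : Fin K → ℝ) (P₀ : ℝ) (k : Fin K) : ℝ := d k ^ 2 * (γ' k * P₀)

theorem conjTranspose_fading (d : Fin K → ℝ) : (fading d)ᴴ = fading d := by
  rw [fading, diagonal_conjTranspose]
  congr 1
  ext k
  simp

theorem receivedCov_eq (d : Fin K → ℝ) (N₀ : ℝ) (Xp : Matrix (Fin K) (Fin τ) ℂ) :
    receivedCov d N₀ Xp
      = (fading d * Xp)ᴴ * (fading d * Xp) + (N₀ : ℂ) • (1 : Matrix (Fin τ) (Fin τ) ℂ) := by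
  rw [receivedCov, conjTranspose_mul, conjTranspose_fading, pow_two]
  simp only [Matrix.mul_assoc]

theorem posDef_add_smul_one {m : ℕ} {A : Matrix (Fin m) (Fin m) ℂ} (hA : A.PosSemidef)
    (hN₀ : 0 < N₀) : (A + (N₀ : ℂ) • (1 : Matrix (Fin m) (Fin m) ℂ)).PosDef :=
  PosDef.posSemidef_add hA (PosDef.one.smul (by exact_mod_cast hN₀))

theorem posDef_receivedCov (hN₀ : 0 < N₀) : (receivedCov d N₀ Xp).PosDef := by
  rw [receivedCov_eq]
  exact posDef_add_smul_one (posSemidef_conjTranspose_mul_self _) hN₀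

/-- The covariance `D X_p X_p† D + N₀ I` of the decorrelated training signal. -/
def pilotGram (d : Fin K → ℝ) (N₀ : ℝ) (Xp : Matrix (Fin K) (Fin τ) ℂ) :
    Matrix (Fin K) (Fin K) ℂ :=
  (fading d * Xp) * (fading d * Xp)ᴴ + (N₀ : ℂ) • 1

theorem posDef_pilotGram (hN₀ : 0 < N₀) : (pilotGram d N₀ Xp).PosDef :=
  posDef_add_smul_one (posSemidef_self_mul_conjTranspose _) hN₀

theorem pilotGram_eq (d : Fin K → ℝ) (N₀ : ℝ) (Xp : Matrix (Fin K) (Fin τ) ℂ) :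
    pilotGram d N₀ Xp = fading d * (Xp * Xpᴴ) * fading d + (N₀ : ℂ) • 1 := by
  rw [pilotGram, conjTranspose_mul, conjTranspose_fading]
  simp only [Matrix.mul_assoc]

theorem one_sub_errorCov (d : Fin K → ℝ) (N₀ : ℝ) (Xp : Matrix (Fin K) (Fin τ) ℂ) :
    1 - errorCov d N₀ Xp
      = (fading d * Xp) * (receivedCov d N₀ Xp)⁻¹ * (fading d * Xp)ᴴ := by
  rw [errorCov, sub_sub_cancel, conjTranspose_mul, conjTranspose_fading]
  simp only [Matrix.mul_assoc]

/-- Push-through: for `A = D X_p`, `A† (A A† + N₀ I) = (A† A + N₀ I) A†`. Hence `(I - M) G = A A† =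
G - N₀ I`, that is, `M G = N₀ I`. -/
theorem errorCov_eq_smul_inv (hN₀ : 0 < N₀) :
    errorCov d N₀ Xp = (N₀ : ℂ) • (pilotGram d N₀ Xp)⁻¹ := by
  have hu : IsUnit (receivedCov d N₀ Xp).det :=
    (Matrix.isUnit_iff_isUnit_det _).mp (posDef_receivedCov hN₀).isUnit
  have hu' : IsUnit (pilotGram d N₀ Xp).det :=
    (Matrix.isUnit_iff_isUnit_det _).mp (posDef_pilotGram hN₀).isUnit
  have hpush : (fading d * Xp)ᴴ * pilotGram d N₀ Xp
      = receivedCov d N₀ Xp * (fading d * Xp)ᴴ := by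
    rw [pilotGram, receivedCov_eq]
    simp only [Matrix.mul_add, Matrix.add_mul, Matrix.mul_smul, Matrix.smul_mul, Matrix.mul_one,
      Matrix.one_mul, Matrix.mul_assoc]
  have hmul : errorCov d N₀ Xp * pilotGram d N₀ Xp = (N₀ : ℂ) • 1 := by
    have h1 : (1 - errorCov d N₀ Xp) * pilotGram d N₀ Xp
        = (fading d * Xp) * (fading d * Xp)ᴴ := by
      rw [one_sub_errorCov, Matrix.mul_assoc, hpush, Matrix.mul_assoc,
        nonsing_inv_mul_cancel_left _ _ hu]
    rw [Matrix.sub_mul, Matrix.one_mul, sub_eq_iff_eq_add] at h1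
    exact add_left_cancel (h1.symm.trans rfl)
  rw [← mul_nonsing_inv_cancel_right _ (errorCov d N₀ Xp) hu', hmul, Matrix.smul_mul,
    Matrix.one_mul]

theorem fading_sq_mul_dataCov (d γ' : Fin K → ℝ) (P₀ : ℝ) :
    fading d ^ 2 * dataCov γ' P₀ = diagonal fun k => (receivedPower d γ' P₀ k : ℂ) := by
  rw [pow_two, fading, dataCov, diagonal_mul_diagonal, diagonal_mul_diagonal]
  congr 1
  ext k
  simp only [receivedPower]
  push_cast
  ring

theorem noisePower_eq (d γ' : Fin K → ℝ) (P₀ N₀ : ℝ) (Xp : Matrix (Fin K) (Fin τ) ℂ) :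
    noisePower d γ' P₀ N₀ Xp
      = ∑ k, receivedPower d γ' P₀ k * (errorCov d N₀ Xp k k).re + N₀ := by
  rw [noisePower, Matrix.mul_assoc, fading_sq_mul_dataCov]
  simp only [trace, diag_apply, mul_diagonal, Complex.re_sum, Complex.re_mul_ofReal]
  simp only [mul_comm]

theorem receivedPower_nonneg (hγ' : ∀ k, 0 ≤ γ' k) (hP₀ : 0 < P₀) (k : Fin K) :
    0 ≤ receivedPower d γ' P₀ k :=
  mul_nonneg (sq_nonneg _) (mul_nonneg (hγ' k) hP₀.le)

theorem errorCov_re_diag (hN₀ : 0 < N₀) (k : Fin K) :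
    (errorCov d N₀ Xp k k).re = N₀ * ((pilotGram d N₀ Xp)⁻¹ k k).re := by
  rw [errorCov_eq_smul_inv hN₀, Matrix.smul_apply, smul_eq_mul, Complex.re_ofReal_mul]

theorem noisePower_pos (hγ' : ∀ k, 0 ≤ γ' k) (hP₀ : 0 < P₀) (hN₀ : 0 < N₀) :
    0 < noisePower d γ' P₀ N₀ Xp := by
  rw [noisePower_eq]
  refine add_pos_of_nonneg_of_pos (Finset.sum_nonneg fun k _ =>
    mul_nonneg (receivedPower_nonneg hγ' hP₀ k) ?_) hN₀
  rw [errorCov_re_diag hN₀]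
  exact mul_nonneg hN₀.le
    (Complex.nonneg_iff.mp (posDef_pilotGram hN₀).inv.posSemidef.diag_nonneg).1

/-- The covariance of the rows of `σ_v⁻¹ Ĥ D R_{X_d}^{1/2}`. -/
noncomputable def signalCov (d γ' : Fin K → ℝ) (P₀ N₀ : ℝ) (Xp : Matrix (Fin K) (Fin τ) ℂ) :
    Matrix (Fin K) (Fin K) ℂ :=
  (((noisePower d γ' P₀ N₀ Xp)⁻¹ : ℝ) : ℂ) • (sqrtDiagonal (receivedPower d γ' P₀)
    * (1 - errorCov d N₀ Xp) * sqrtDiagonal (receivedPower d γ' P₀))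

theorem posSemidef_signalCov (hγ' : ∀ k, 0 ≤ γ' k) (hP₀ : 0 < P₀) (hN₀ : 0 < N₀) :
    (signalCov d γ' P₀ N₀ Xp).PosSemidef := by
  have h1 : (1 - errorCov d N₀ Xp).PosSemidef := by
    rw [one_sub_errorCov]
    exact (posDef_receivedCov hN₀).inv.posSemidef.mul_mul_conjTranspose_same _
  have h2 := h1.mul_mul_conjTranspose_same (sqrtDiagonal (receivedPower d γ' P₀))
  rw [conjTranspose_sqrtDiagonal] at h2
  exact h2.smul (by exact_mod_cast (inv_pos.mpr (noisePower_pos hγ' hP₀ hN₀)).le)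

theorem signalCov_re_diag (hγ' : ∀ k, 0 ≤ γ' k) (hP₀ : 0 < P₀) (k : Fin K) :
    (signalCov d γ' P₀ N₀ Xp k k).re = (noisePower d γ' P₀ N₀ Xp)⁻¹
      * (receivedPower d γ' P₀ k * (1 - (errorCov d N₀ Xp k k).re)) := by
  have hsq := Real.mul_self_sqrt (receivedPower_nonneg (d := d) hγ' hP₀ k)
  rw [signalCov, Matrix.smul_apply, smul_eq_mul, Complex.re_ofReal_mul, sqrtDiagonal,
    mul_diagonal, diagonal_mul, Complex.re_mul_ofReal, Complex.re_ofReal_mul, Matrix.sub_apply,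
    one_apply_eq, Complex.sub_re, Complex.one_re]
  linear_combination (noisePower d γ' P₀ N₀ Xp)⁻¹ * (1 - (errorCov d N₀ Xp k k).re) * hsq

/-- `V` gathers everything that multiplies `Y_p` on the right, including `σ_v⁻¹` and the square root
of the received powers, so that the argument of `logDetGram` is linear in `(H, W_p)`. -/
theorem instRate_eq (hγ' : ∀ k, 0 ≤ γ' k) (hP₀ : 0 < P₀) (hN₀ : 0 < N₀)
    (ω : (Fin N → Fin K → ℂ) × (Fin N → Fin τ → ℂ)) :
    let V := ((√(noisePower d γ' P₀ N₀ Xp)⁻¹ : ℝ) : ℂ) • ((receivedCov d N₀ Xp)⁻¹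
      * (fading d * Xp)ᴴ * sqrtDiagonal (receivedPower d γ' P₀))
    instRate d γ' P₀ N₀ Xp ω = (Real.log 2)⁻¹
      * logDetGram (Matrix.of ω.1 * (fading d * Xp * V) + Matrix.of ω.2 * V) := by
  intro V
  set c := (noisePower d γ' P₀ N₀ Xp)⁻¹ with hc
  have hc0 : 0 ≤ c := (inv_pos.mpr (noisePower_pos hγ' hP₀ hN₀)).le
  set E := channelEstimate d N₀ Xp (received d Xp (Matrix.of ω.1) (Matrix.of ω.2)) with hE
  have hHV : Matrix.of ω.1 * (fading d * Xp * V) + Matrix.of ω.2 * V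
      = ((√c : ℝ) : ℂ) • (E * sqrtDiagonal (receivedPower d γ' P₀)) := by
    simp only [V, hc, hE, channelEstimate, received, conjTranspose_mul, conjTranspose_fading,
      Matrix.mul_smul, ← smul_add, Matrix.add_mul, Matrix.mul_assoc]
  have hDRD : fading d * (dataCov γ' P₀ * fading d)
      = sqrtDiagonal (receivedPower d γ' P₀) * sqrtDiagonal (receivedPower d γ' P₀) := by
    rw [sqrtDiagonal_mul_self (receivedPower_nonneg hγ' hP₀), ← fading_sq_mul_dataCov, fading,
      dataCov, pow_two]
    simp only [diagonal_mul_diagonal]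
    congr 1
    ext k
    ring
  have hgram : (Matrix.of ω.1 * (fading d * Xp * V) + Matrix.of ω.2 * V)
      * (Matrix.of ω.1 * (fading d * Xp * V) + Matrix.of ω.2 * V)ᴴ
      = ((noisePower d γ' P₀ N₀ Xp : ℝ) : ℂ)⁻¹
        • (E * fading d * dataCov γ' P₀ * fading d * Eᴴ) := by
    have hcc : ((√c : ℝ) : ℂ) * ((√c : ℝ) : ℂ) = ((noisePower d γ' P₀ N₀ Xp : ℝ) : ℂ)⁻¹ := by
      rw [← Complex.ofReal_mul, Real.mul_self_sqrt hc0, hc, Complex.ofReal_inv]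
    have hassoc : E * fading d * dataCov γ' P₀ * fading d * Eᴴ
        = E * (fading d * (dataCov γ' P₀ * fading d)) * Eᴴ := by
      simp only [Matrix.mul_assoc]
    rw [hHV, hassoc, hDRD, conjTranspose_smul, conjTranspose_mul, conjTranspose_sqrtDiagonal,
      Matrix.smul_mul, Matrix.mul_smul, smul_smul, ← hcc]
    simp only [RCLike.star_def, Complex.conj_ofReal, Matrix.mul_assoc]
  simp only [instRate, logDetGram, hgram]
  rw [Real.logb, div_eq_inv_mul]

/-- The two contributions combine to `V† (A† A + N₀ I) V` with `A = D X_p`, and one factor of the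
received covariance cancels against its inverse in `V`. -/
theorem rowCov_eq_signalCov (hγ' : ∀ k, 0 ≤ γ' k) (hP₀ : 0 < P₀) (hN₀ : 0 < N₀) :
    let V := ((√(noisePower d γ' P₀ N₀ Xp)⁻¹ : ℝ) : ℂ) • ((receivedCov d N₀ Xp)⁻¹
      * (fading d * Xp)ᴴ * sqrtDiagonal (receivedPower d γ' P₀))
    (fading d * Xp * V)ᴴ * (fading d * Xp * V) + (N₀ : ℂ) • (Vᴴ * V)
      = signalCov d γ' P₀ N₀ Xp := by
  intro V
  have hc0 := (inv_pos.mpr (noisePower_pos (d := d) (Xp := Xp) hγ' hP₀ hN₀)).le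
  have hC := posDef_receivedCov (d := d) (Xp := Xp) hN₀
  have hu : IsUnit (receivedCov d N₀ Xp).det := (Matrix.isUnit_iff_isUnit_det _).mp hC.isUnit
  have h1 : (fading d * Xp * V)ᴴ * (fading d * Xp * V) + (N₀ : ℂ) • (Vᴴ * V)
      = Vᴴ * receivedCov d N₀ Xp * V := by
    rw [receivedCov_eq, conjTranspose_mul]
    simp only [Matrix.mul_add, Matrix.add_mul, Matrix.mul_smul, Matrix.smul_mul, Matrix.mul_one,
      Matrix.mul_assoc]
  have h2 : receivedCov d N₀ Xp * V = ((√(noisePower d γ' P₀ N₀ Xp)⁻¹ : ℝ) : ℂ)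
      • ((fading d * Xp)ᴴ * sqrtDiagonal (receivedPower d γ' P₀)) := by
    simp only [V, Matrix.mul_smul, Matrix.mul_assoc, mul_nonsing_inv_cancel_left _ _ hu]
  have hcc : ((√(noisePower d γ' P₀ N₀ Xp)⁻¹ : ℝ) : ℂ)
        * ((√(noisePower d γ' P₀ N₀ Xp)⁻¹ : ℝ) : ℂ)
      = (((noisePower d γ' P₀ N₀ Xp)⁻¹ : ℝ) : ℂ) := by
    rw [← Complex.ofReal_mul, Real.mul_self_sqrt hc0]
  rw [h1, Matrix.mul_assoc, h2, signalCov, one_sub_errorCov, ← hcc]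
  simp only [V, conjTranspose_smul, conjTranspose_mul, conjTranspose_conjTranspose,
    conjTranspose_sqrtDiagonal, conjTranspose_fading, hC.inv.1.eq, Matrix.smul_mul,
    Matrix.mul_smul, smul_smul, RCLike.star_def, Complex.conj_ofReal, Matrix.mul_assoc]

theorem throughput_eq (hγ' : ∀ k, 0 ≤ γ' k) (hP₀ : 0 < P₀) (hN₀ : 0 < N₀) (α : ℝ)
    {S : Matrix (Fin K) (Fin K) ℂ} (hS : signalCov d γ' P₀ N₀ Xp = Sᴴ * S) :
    throughput N α d γ' P₀ N₀ Xp = (1 - α) * ((Real.log 2)⁻¹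
      * ∫ Z, logDetGram (Matrix.of Z * S) ∂gaussianEntries N K 1) := by
  simp only [throughput, instRate_eq hγ' hP₀ hN₀, integral_const_mul]
  rw [integral_logDetGram_channelLaw hN₀.le ((rowCov_eq_signalCov hγ' hP₀ hN₀).trans hS)]

/-- The Hermitian square root is needed: the law of `Z S` is governed by `S† S`, whereas the
comparison of diagonals is about `S S†`. -/
theorem exists_sqrt_signalCov (hγ' : ∀ k, 0 ≤ γ' k) (hP₀ : 0 < P₀) (hN₀ : 0 < N₀) :
    ∃ S : Matrix (Fin K) (Fin K) ℂ, signalCov d γ' P₀ N₀ Xp = Sᴴ * S ∧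
      signalCov d γ' P₀ N₀ Xp = S * Sᴴ := by
  open scoped MatrixOrder in
  have h := Matrix.nonneg_iff_posSemidef.mpr
    (posSemidef_signalCov (d := d) (Xp := Xp) hγ' hP₀ hN₀)
  have hsa : (CFC.sqrt (signalCov d γ' P₀ N₀ Xp))ᴴ = CFC.sqrt (signalCov d γ' P₀ N₀ Xp) :=
    (Matrix.nonneg_iff_posSemidef.mp (CFC.sqrt_nonneg _)).1
  refine ⟨CFC.sqrt (signalCov d γ' P₀ N₀ Xp), ?_, ?_⟩ <;>
    rw [hsa, CFC.sqrt_mul_sqrt_self _ h]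

theorem integrable_instRate (hγ' : ∀ k, 0 ≤ γ' k) (hP₀ : 0 < P₀) (hN₀ : 0 < N₀) :
    Integrable (instRate (N := N) d γ' P₀ N₀ Xp) (channelLaw N K τ N₀) := by
  obtain ⟨S, hS, -⟩ := exists_sqrt_signalCov (d := d) (Xp := Xp) hγ' hP₀ hN₀
  have h := (integrable_logDetGram_channelLaw (N := N) hN₀.le
    ((rowCov_eq_signalCov hγ' hP₀ hN₀).trans hS)).const_mul (Real.log 2)⁻¹
  exact h.congr (ae_of_all _ fun ω => (instRate_eq hγ' hP₀ hN₀ ω).symm)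

end Estimate

/-! ### Orthogonal pilots attain the bound, and the case of equality. -/

section Optimality

open scoped ComplexOrder

variable {N K T τ : ℕ} {α : ℝ} {d γ γ' : Fin K → ℝ} {P₀ N₀ : ℝ} {Xp : Matrix (Fin K) (Fin τ) ℂ}

/-- The estimation error `N₀ / (d_k² α γ_k P₀ T + N₀)` of user `k` under orthogonal pilots. -/
noncomputable def orthogonalError (α : ℝ) (T : ℕ) (d γ : Fin K → ℝ) (P₀ N₀ : ℝ) (k : Fin K) : ℝ :=
  N₀ * (d k ^ 2 * (α * γ k * P₀ * T) + N₀)⁻¹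

/-- The equivalent noise power under orthogonal pilots. -/
noncomputable def orthogonalNoisePower (α : ℝ) (T : ℕ) (d γ γ' : Fin K → ℝ) (P₀ N₀ : ℝ) : ℝ :=
  ∑ k, receivedPower d γ' P₀ k * orthogonalError α T d γ P₀ N₀ k + N₀

/-- The diagonal entries of the signal covariance under orthogonal pilots. -/
noncomputable def orthogonalSignal (α : ℝ) (T : ℕ) (d γ γ' : Fin K → ℝ) (P₀ N₀ : ℝ) (k : Fin K) :
    ℝ :=
  (orthogonalNoisePower α T d γ γ' P₀ N₀)⁻¹
    * (receivedPower d γ' P₀ k * (1 - orthogonalError α T d γ P₀ N₀ k))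

theorem orthogonalError_nonneg (hα : 0 ≤ α) (hγ : ∀ k, 0 ≤ γ k) (hP₀ : 0 < P₀) (hN₀ : 0 < N₀)
    (k : Fin K) : 0 ≤ orthogonalError α T d γ P₀ N₀ k := by
  have := hγ k
  unfold orthogonalError
  positivity

theorem orthogonalError_le_one (hα : 0 ≤ α) (hγ : ∀ k, 0 ≤ γ k) (hP₀ : 0 < P₀) (hN₀ : 0 < N₀)
    (k : Fin K) : orthogonalError α T d γ P₀ N₀ k ≤ 1 := by
  have := hγ k
  have h : 0 ≤ d k ^ 2 * (α * γ k * P₀ * T) := by positivity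
  rw [orthogonalError, ← div_eq_mul_inv, div_le_one (by positivity)]
  linarith

theorem orthogonalNoisePower_pos (hα : 0 ≤ α) (hγ : ∀ k, 0 ≤ γ k) (hγ' : ∀ k, 0 ≤ γ' k)
    (hP₀ : 0 < P₀) (hN₀ : 0 < N₀) : 0 < orthogonalNoisePower α T d γ γ' P₀ N₀ :=
  add_pos_of_nonneg_of_pos (Finset.sum_nonneg fun k _ =>
    mul_nonneg (receivedPower_nonneg hγ' hP₀ k) (orthogonalError_nonneg hα hγ hP₀ hN₀ k)) hN₀

theorem orthogonalSignal_nonneg (hα : 0 ≤ α) (hγ : ∀ k, 0 ≤ γ k) (hγ' : ∀ k, 0 ≤ γ' k)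
    (hP₀ : 0 < P₀) (hN₀ : 0 < N₀) (k : Fin K) : 0 ≤ orthogonalSignal α T d γ γ' P₀ N₀ k :=
  mul_nonneg (inv_pos.mpr (orthogonalNoisePower_pos hα hγ hγ' hP₀ hN₀)).le
    (mul_nonneg (receivedPower_nonneg hγ' hP₀ k)
      (sub_nonneg.mpr (orthogonalError_le_one hα hγ hP₀ hN₀ k)))

theorem IsFeasible.apply_self (h : IsFeasible α T γ P₀ Xp) (k : Fin K) :
    (Xp * Xpᴴ) k k = ((α * γ k * P₀ * T : ℝ) : ℂ) := by
  have := congrFun (congrFun h k) k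
  rwa [pilotEnergy, diagonal_apply_eq, diagonal_apply_eq, diag_apply] at this

theorem isFeasible_of_mul_conjTranspose_eq (h : Xp * Xpᴴ = pilotEnergy α T γ P₀) :
    IsFeasible α T γ P₀ Xp := by
  rw [IsFeasible, h, pilotEnergy, diag_diagonal]

theorem pilotGram_apply (d : Fin K → ℝ) (N₀ : ℝ) (Xp : Matrix (Fin K) (Fin τ) ℂ) (k l : Fin K) :
    pilotGram d N₀ Xp k l
      = d k * (Xp * Xpᴴ) k l * d l + N₀ * (1 : Matrix (Fin K) (Fin K) ℂ) k l := by
  rw [pilotGram_eq, Matrix.add_apply, Matrix.smul_apply, smul_eq_mul, fading, mul_diagonal,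
    diagonal_mul]

theorem IsFeasible.pilotGram_re_diag (h : IsFeasible α T γ P₀ Xp) (k : Fin K) :
    (pilotGram d N₀ Xp k k).re = d k ^ 2 * (α * γ k * P₀ * T) + N₀ := by
  rw [pilotGram_apply, h.apply_self, one_apply_eq, mul_one, Complex.add_re, Complex.re_mul_ofReal,
    Complex.re_ofReal_mul, Complex.ofReal_re, Complex.ofReal_re]
  ring

theorem IsFeasible.orthogonalError_le (h : IsFeasible α T γ P₀ Xp) (hN₀ : 0 < N₀) (k : Fin K) :
    orthogonalError α T d γ P₀ N₀ k ≤ (errorCov d N₀ Xp k k).re := by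
  rw [errorCov_re_diag hN₀, orthogonalError, ← h.pilotGram_re_diag]
  exact mul_le_mul_of_nonneg_left (inv_re_diag_le (posDef_pilotGram hN₀) k) hN₀.le

theorem IsFeasible.orthogonalError_lt (h : IsFeasible α T γ P₀ Xp) (hN₀ : 0 < N₀) {l k : Fin K}
    (hlk : l ≠ k) (hX : (Xp * Xpᴴ) l k ≠ 0) (hdl : d l ≠ 0) (hdk : d k ≠ 0) :
    orthogonalError α T d γ P₀ N₀ k < (errorCov d N₀ Xp k k).re := by
  rw [errorCov_re_diag hN₀, orthogonalError, ← h.pilotGram_re_diag]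
  refine mul_lt_mul_of_pos_left (inv_re_diag_lt (posDef_pilotGram hN₀) hlk ?_) hN₀
  rw [pilotGram_apply, one_apply_ne hlk, mul_zero, add_zero]
  exact mul_ne_zero (mul_ne_zero (Complex.ofReal_ne_zero.mpr hdl) hX)
    (Complex.ofReal_ne_zero.mpr hdk)

theorem IsFeasible.orthogonalNoisePower_le (h : IsFeasible α T γ P₀ Xp) (hγ' : ∀ k, 0 ≤ γ' k)
    (hP₀ : 0 < P₀) (hN₀ : 0 < N₀) :
    orthogonalNoisePower α T d γ γ' P₀ N₀ ≤ noisePower d γ' P₀ N₀ Xp := by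
  rw [noisePower_eq, orthogonalNoisePower]
  gcongr with k
  · exact receivedPower_nonneg hγ' hP₀ k
  · exact h.orthogonalError_le hN₀ k

/-- Non-orthogonality hurts twice: the estimated power `1 - M k k` drops and the noise power in the
denominator rises. -/
theorem IsFeasible.signalCov_re_diag_le (h : IsFeasible α T γ P₀ Xp) (hα : 0 ≤ α)
    (hγ : ∀ k, 0 ≤ γ k) (hγ' : ∀ k, 0 ≤ γ' k) (hP₀ : 0 < P₀) (hN₀ : 0 < N₀) (k : Fin K) :
    (signalCov d γ' P₀ N₀ Xp k k).re ≤ orthogonalSignal α T d γ γ' P₀ N₀ k := by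
  have hr := receivedPower_nonneg (d := d) hγ' hP₀ k
  have he := sub_nonneg.mpr (orthogonalError_le_one (T := T) (d := d) hα hγ hP₀ hN₀ k)
  rw [signalCov_re_diag hγ' hP₀, orthogonalSignal]
  refine (mul_le_mul_of_nonneg_left (mul_le_mul_of_nonneg_left
    (sub_le_sub_left (h.orthogonalError_le hN₀ k) 1) hr)
    (inv_pos.mpr (noisePower_pos hγ' hP₀ hN₀)).le).trans ?_
  exact mul_le_mul_of_nonneg_right (inv_anti₀ (orthogonalNoisePower_pos hα hγ hγ' hP₀ hN₀)
    (h.orthogonalNoisePower_le hγ' hP₀ hN₀)) (mul_nonneg hr he)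

theorem IsFeasible.signalCov_re_diag_lt (h : IsFeasible α T γ P₀ Xp) (hα : 0 ≤ α)
    (hγ : ∀ k, 0 ≤ γ k) (hγ' : ∀ k, 0 ≤ γ' k) (hP₀ : 0 < P₀) (hN₀ : 0 < N₀) {l k : Fin K}
    (hlk : l ≠ k) (hX : (Xp * Xpᴴ) l k ≠ 0) (hdl : d l ≠ 0) (hdk : d k ≠ 0) (hk : 0 < γ' k) :
    (signalCov d γ' P₀ N₀ Xp k k).re < orthogonalSignal α T d γ γ' P₀ N₀ k := by
  have hr : 0 < receivedPower d γ' P₀ k := mul_pos (by positivity) (mul_pos hk hP₀)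
  have he := sub_nonneg.mpr (orthogonalError_le_one (T := T) (d := d) hα hγ hP₀ hN₀ k)
  rw [signalCov_re_diag hγ' hP₀, orthogonalSignal]
  refine (mul_lt_mul_of_pos_left (mul_lt_mul_of_pos_left
    (sub_lt_sub_left (h.orthogonalError_lt hN₀ hlk hX hdl hdk) 1) hr)
    (inv_pos.mpr (noisePower_pos hγ' hP₀ hN₀))).trans_le ?_
  exact mul_le_mul_of_nonneg_right (inv_anti₀ (orthogonalNoisePower_pos hα hγ hγ' hP₀ hN₀)
    (h.orthogonalNoisePower_le hγ' hP₀ hN₀)) (mul_nonneg hr.le he)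

/-- The throughput of orthogonal pilots with the prescribed energies. -/
noncomputable def orthogonalThroughput (N : ℕ) (α : ℝ) (T : ℕ) (d γ γ' : Fin K → ℝ)
    (P₀ N₀ : ℝ) : ℝ :=
  (1 - α) * ((Real.log 2)⁻¹ * ∫ Z, logDetGram
    (Matrix.of Z * sqrtDiagonal (orthogonalSignal α T d γ γ' P₀ N₀)) ∂gaussianEntries N K 1)

theorem IsFeasible.throughput_le (h : IsFeasible α T γ P₀ Xp) (hα0 : 0 ≤ α) (hα1 : α < 1)
    (hγ : ∀ k, 0 ≤ γ k) (hγ' : ∀ k, 0 ≤ γ' k) (hP₀ : 0 < P₀) (hN₀ : 0 < N₀) :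
    throughput N α d γ' P₀ N₀ Xp ≤ orthogonalThroughput N α T d γ γ' P₀ N₀ := by
  obtain ⟨S, hS, hS'⟩ := exists_sqrt_signalCov (d := d) (Xp := Xp) hγ' hP₀ hN₀
  rw [throughput_eq hγ' hP₀ hN₀ α hS, orthogonalThroughput]
  refine mul_le_mul_of_nonneg_left (mul_le_mul_of_nonneg_left ?_
    (inv_pos.mpr (Real.log_pos one_lt_two)).le) (sub_pos.mpr hα1).le
  refine integral_logDetGram_mul_le (orthogonalSignal_nonneg hα0 hγ hγ' hP₀ hN₀) fun k => ?_
  rw [← hS']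
  exact h.signalCov_re_diag_le hα0 hγ hγ' hP₀ hN₀ k

theorem IsFeasible.throughput_lt (hN : 0 < N) (h : IsFeasible α T γ P₀ Xp) (hα0 : 0 ≤ α)
    (hα1 : α < 1) (hγ : ∀ k, 0 ≤ γ k) (hγ' : ∀ k, 0 ≤ γ' k) (hP₀ : 0 < P₀) (hN₀ : 0 < N₀)
    {l k : Fin K} (hlk : l ≠ k) (hX : (Xp * Xpᴴ) l k ≠ 0) (hdl : d l ≠ 0) (hdk : d k ≠ 0)
    (hk : 0 < γ' k) :
    throughput N α d γ' P₀ N₀ Xp < orthogonalThroughput N α T d γ γ' P₀ N₀ := by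
  obtain ⟨S, hS, hS'⟩ := exists_sqrt_signalCov (d := d) (Xp := Xp) hγ' hP₀ hN₀
  rw [throughput_eq hγ' hP₀ hN₀ α hS, orthogonalThroughput]
  refine mul_lt_mul_of_pos_left (mul_lt_mul_of_pos_left ?_
    (inv_pos.mpr (Real.log_pos one_lt_two))) (sub_pos.mpr hα1)
  refine integral_logDetGram_mul_lt (i := k) hN (orthogonalSignal_nonneg hα0 hγ hγ' hP₀ hN₀)
    (fun k => ?_) ?_
  · rw [← hS']
    exact h.signalCov_re_diag_le hα0 hγ hγ' hP₀ hN₀ k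
  · rw [← hS']
    exact h.signalCov_re_diag_lt hα0 hγ hγ' hP₀ hN₀ hlk hX hdl hdk hk

theorem errorCov_of_orthogonal (h : Xp * Xpᴴ = pilotEnergy α T γ P₀) (hα : 0 ≤ α)
    (hγ : ∀ k, 0 ≤ γ k) (hP₀ : 0 < P₀) (hN₀ : 0 < N₀) :
    errorCov d N₀ Xp = diagonal fun k => (orthogonalError α T d γ P₀ N₀ k : ℂ) := by
  have hu : IsUnit (pilotGram d N₀ Xp).det :=
    (Matrix.isUnit_iff_isUnit_det _).mp (posDef_pilotGram hN₀).isUnit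
  have hgram : pilotGram d N₀ Xp
      = diagonal fun k => ((d k ^ 2 * (α * γ k * P₀ * T) + N₀ : ℝ) : ℂ) := by
    ext k l
    rw [pilotGram_apply, h, pilotEnergy]
    by_cases hkl : k = l
    · subst hkl
      simp only [diagonal_apply_eq, one_apply_eq]
      push_cast
      ring
    · simp only [diagonal_apply_ne _ hkl, one_apply_ne hkl, mul_zero, zero_mul, add_zero]
  have hmul : (diagonal fun k => (orthogonalError α T d γ P₀ N₀ k : ℂ)) * pilotGram d N₀ Xp
      = (N₀ : ℂ) • 1 := by
    rw [hgram, diagonal_mul_diagonal, ← diagonal_one, ← diagonal_smul]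
    congr 1
    ext k
    have hk := hγ k
    have hpos : 0 < d k ^ 2 * (α * γ k * P₀ * T) + N₀ := by positivity
    rw [← Complex.ofReal_mul, orthogonalError, mul_assoc, inv_mul_cancel₀ hpos.ne']
    simp
  rw [errorCov_eq_smul_inv hN₀, ← mul_nonsing_inv_cancel_right _
    (diagonal fun k => (orthogonalError α T d γ P₀ N₀ k : ℂ)) hu, hmul, Matrix.smul_mul,
    Matrix.one_mul]

theorem throughput_of_orthogonal (h : Xp * Xpᴴ = pilotEnergy α T γ P₀) (hα : 0 ≤ α)
    (hγ : ∀ k, 0 ≤ γ k) (hγ' : ∀ k, 0 ≤ γ' k) (hP₀ : 0 < P₀) (hN₀ : 0 < N₀) :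
    throughput N α d γ' P₀ N₀ Xp = orthogonalThroughput N α T d γ γ' P₀ N₀ := by
  have herr := errorCov_of_orthogonal (d := d) h hα hγ hP₀ hN₀
  have hnoise : noisePower d γ' P₀ N₀ Xp = orthogonalNoisePower α T d γ γ' P₀ N₀ := by
    simp only [noisePower_eq, herr, diagonal_apply_eq, Complex.ofReal_re, orthogonalNoisePower]
  refine throughput_eq hγ' hP₀ hN₀ α ?_
  rw [conjTranspose_sqrtDiagonal,
    sqrtDiagonal_mul_self (orthogonalSignal_nonneg hα hγ hγ' hP₀ hN₀), signalCov, herr, hnoise,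
    ← diagonal_one, diagonal_sub, sqrtDiagonal, diagonal_mul_diagonal, diagonal_mul_diagonal,
    ← diagonal_smul]
  congr 1
  ext k
  have hsq : ((√(receivedPower d γ' P₀ k) : ℝ) : ℂ) * ((√(receivedPower d γ' P₀ k) : ℝ) : ℂ)
      = (receivedPower d γ' P₀ k : ℂ) := by
    rw [← Complex.ofReal_mul, Real.mul_self_sqrt (receivedPower_nonneg hγ' hP₀ k)]
  simp only [Pi.smul_apply, smul_eq_mul, orthogonalSignal, Complex.ofReal_mul, Complex.ofReal_sub,
    Complex.ofReal_one, ← hsq]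
  ring

/-- The first `K` rows of the identity of size `τ` are orthonormal; row `k` is scaled by `√(p k)`.
-/
theorem exists_mul_conjTranspose_eq_diagonal (hK : K ≤ τ) {p : Fin K → ℝ} (hp : ∀ k, 0 ≤ p k) :
    ∃ Xp : Matrix (Fin K) (Fin τ) ℂ, Xp * Xpᴴ = diagonal fun k => (p k : ℂ) := by
  refine ⟨sqrtDiagonal p * (1 : Matrix (Fin τ) (Fin τ) ℂ).submatrix
    (Fin.castLE hK) id, ?_⟩
  have h1 : (1 : Matrix (Fin τ) (Fin τ) ℂ).submatrix (Fin.castLE hK) id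
      * ((1 : Matrix (Fin τ) (Fin τ) ℂ).submatrix (Fin.castLE hK) id)ᴴ = 1 := by
    rw [conjTranspose_submatrix, ← submatrix_mul _ _ _ _ _ Function.bijective_id,
      conjTranspose_one, Matrix.mul_one, submatrix_one _ (Fin.castLE_injective hK)]
  rw [conjTranspose_mul, Matrix.mul_assoc, ← Matrix.mul_assoc _ _ (sqrtDiagonal p)ᴴ, h1,
    Matrix.one_mul, conjTranspose_sqrtDiagonal, sqrtDiagonal_mul_self hp]

/-- A user without pilot energy has no pilots. -/
theorem IsFeasible.row_eq_zero (h : IsFeasible α T γ P₀ Xp) {k : Fin K} (hk : γ k = 0)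
    (j : Fin τ) : Xp k j = 0 := by
  have hkk := congrArg Complex.re (h.apply_self k)
  simp only [hk, mul_zero, zero_mul, Complex.ofReal_zero, Complex.zero_re, mul_apply,
    conjTranspose_apply, RCLike.star_def, Complex.mul_conj, Complex.re_sum,
    Complex.ofReal_re] at hkk
  exact Complex.normSq_eq_zero.mp
    ((Finset.sum_eq_zero_iff_of_nonneg fun j _ => Complex.normSq_nonneg _).mp hkk j
      (Finset.mem_univ j))

/-- Feasibility settles the diagonal, and users with zero pilot power have zero rows, so a violation
must occur between two users with positive pilot power. Only these are covered by the activity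
hypothesis of the converse. -/
theorem IsFeasible.exists_offDiag_ne_zero (h : IsFeasible α T γ P₀ Xp) (hγ : ∀ k, 0 ≤ γ k)
    (hne : Xp * Xpᴴ ≠ pilotEnergy α T γ P₀) :
    ∃ l k, l ≠ k ∧ (Xp * Xpᴴ) l k ≠ 0 ∧ 0 < γ l ∧ 0 < γ k := by
  by_contra! hall
  refine hne ?_
  ext l k
  by_cases hlk : l = k
  · subst hlk
    rw [h.apply_self, pilotEnergy, diagonal_apply_eq]
  · rw [pilotEnergy, diagonal_apply_ne _ hlk]
    by_contra hX
    have hl : 0 < γ l := by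
      refine lt_of_le_of_ne (hγ l) fun h0 => hX ?_
      rw [mul_apply]
      exact Finset.sum_eq_zero fun j _ => by rw [h.row_eq_zero h0.symm, zero_mul]
    have hk0 := le_antisymm (hall l k hlk hX hl) (hγ k)
    refine hX ?_
    rw [mul_apply]
    exact Finset.sum_eq_zero fun j _ => by
      rw [conjTranspose_apply, h.row_eq_zero hk0, star_zero, mul_zero]

end Optimality

end PilotDesign

theorem mainTheorem7 (N K T τ : ℕ) (hN : 0 < N) (α : ℝ) (hα0 : 0 < α) (hα1 : α < 1)
    (hτ : α * (T : ℝ) = (τ : ℝ)) (hK : K ≤ τ)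
    (d γ γ' : Fin K → ℝ) (hd : ∀ k, 0 ≤ d k) (hγ : ∀ k, 0 ≤ γ k) (hγ' : ∀ k, 0 ≤ γ' k)
    (P₀ N₀ : ℝ) (hP₀ : 0 < P₀) (hN₀ : 0 < N₀) :
    -- the expectation defining the throughput exists
    (∀ Xp : Matrix (Fin K) (Fin τ) ℂ, PilotDesign.IsFeasible α T γ P₀ Xp →
      Integrable (PilotDesign.instRate (N := N) d γ' P₀ N₀ Xp)
        (PilotDesign.channelLaw N K τ N₀)) ∧
    -- pilot matrices that are orthogonal with the prescribed powers exist
    (∃ Xp : Matrix (Fin K) (Fin τ) ℂ, Xp * Xpᴴ = PilotDesign.pilotEnergy α T γ P₀) ∧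
    -- each of them is optimal
    (∀ Xp : Matrix (Fin K) (Fin τ) ℂ, Xp * Xpᴴ = PilotDesign.pilotEnergy α T γ P₀ →
      PilotDesign.IsOptimal N T α d γ γ' P₀ N₀ Xp) ∧
    -- and there are no other optimal ones, if each user that sends pilots is received and sends data
    ((∀ k, 0 < γ k → 0 < d k ∧ 0 < γ' k) →
      ∀ Xp : Matrix (Fin K) (Fin τ) ℂ, PilotDesign.IsOptimal N T α d γ γ' P₀ N₀ Xp →
        Xp * Xpᴴ = PilotDesign.pilotEnergy α T γ P₀) := by
  obtain ⟨X₀, hX₀⟩ : ∃ Xp : Matrix (Fin K) (Fin τ) ℂ,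
      Xp * Xpᴴ = PilotDesign.pilotEnergy α T γ P₀ :=
    PilotDesign.exists_mul_conjTranspose_eq_diagonal hK fun k => by
      have := hγ k
      positivity
  refine ⟨fun Xp _ => PilotDesign.integrable_instRate hγ' hP₀ hN₀, ⟨X₀, hX₀⟩, fun Xp hXp => ?_,
    fun hact Xp hXp => ?_⟩
  · refine ⟨PilotDesign.isFeasible_of_mul_conjTranspose_eq hXp, fun Z hZ => ?_⟩
    rw [PilotDesign.throughput_of_orthogonal hXp hα0.le hγ hγ' hP₀ hN₀]
    exact hZ.throughput_le hα0.le hα1 hγ hγ' hP₀ hN₀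
  · by_contra hne
    obtain ⟨l, k, hlk, hX, hl, hk⟩ := hXp.1.exists_offDiag_ne_zero hγ hne
    have hlt := hXp.1.throughput_lt hN hα0.le hα1 hγ hγ' hP₀ hN₀ hlk hX (hact l hl).1.ne'
      (hact k hk).1.ne' (hact k hk).2
    -- The orthogonal `X₀` attains the upper bound, so an optimal `Xp` cannot lie strictly below it.
    have hle := hXp.2 X₀ (PilotDesign.isFeasible_of_mul_conjTranspose_eq hX₀)
    rw [PilotDesign.throughput_of_orthogonal hX₀ hα0.le hγ hγ' hP₀ hN₀] at hle
    exact absurd hlt hle.not_gt
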